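/- Let $V$ be a finite vertex set, partitioned into seeds $S$ and ambiguous vertices $A=V\setminus S$. Let $b:V\to\{1,\dots,K\}$ ($K\ge 1$) be a block membership function with block sizes $n_i=|b^{-1}(i)|$, let $m_i=|S\cap b^{-1}(i)|$, $n=|V|$, $m=|S|$, and let $\Lambda\in(0,1)^{K\times K}$. Let $\Phi$ be the set of functions $\varphi:V\to\{1,\dots,K\}$ with $\varphi=b$ on $S$ and $|\varphi^{-1}(i)|=n_i$ for all $i$. For a graph $G$ on $V$ and $\varphi\in\Phi$ put $$L_G(\varphi)=\prod_{i\le j}\Lambda_{i,j}^{e_{i,j}}(1-\Lambda_{i,j})^{c_{i,j}},$$ where $e_{i,j}$ is the number of edges of $G$ with $\varphi$-labels $i$ and $j$ at their ends, $c_{i,j}=n_in_j-e_{i,j}$ for $i\ne j$, and $c_{i,i}=\binom{n_i}{2}-e_{i,i}$. Let $\mathbb Q$ be the law of the pair $(\mathbf{G},\phi)$ with $\phi$ uniform on $\Phi$ and, given $\phi=\varphi$, $\mathbf{G}$ drawn from the stochastic block model with membership function $\varphi$; thus $$\mathbb Q(G,\varphi)=\binom{n-m}{n_1-m_1,\dots,n_K-m_K}^{-1}L_G(\varphi),\qquad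 \mathbb Q(\varphi\mid G)=\frac{\mathbb Q(G,\varphi)}{\sum_{\psi\in\Phi}\mathbb Q(G,\psi)},$$ and $\mathbb Q(\phi(v)=1\mid G)=\sum_{\varphi\in\Phi:\varphi(v)=1}\mathbb Q(\varphi\mid G)$. Let $P$ be the Bernoulli–Laplace swap chain on $\Phi$: $P(\varphi,\varphi')=\big(\binom{n-m}{2}-\sum_i\binom{n_i-m_i}{2}\big)^{-1}$ if $\varphi$ and $\varphi'$ differ at exactly two vertices, and $P(\varphi,\varphi')=0$ otherwise. Let $\widehat P$ be the Metropolis–Hastings chain with base chain $P$: $$\widehat P(\varphi,\varphi')=P(\varphi,\varphi')\min\{1,L_G(\varphi')/L_G(\varphi)\}\ \ (\varphi\ne\varphi'),\qquad \widehat P(\varphi,\varphi)=1-\sum_{\varphi''\ne\varphi}\widehat P(\varphi,\varphi'')$$ (if $|\Phi|=1$, then $\widehat P$ is the trivial chain). Then, for every graph $G$ on $V$: 1. If $|\Phi|>1$, then $P$ is a symmetric stochastic matrix. 2. $\widehat P$ is a stochastic matrix on the finite set $\Phi$. It is reversible with respect to the probability distribution $\mathbb Q(\cdot\mid G)$, which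 is therefore stationary, and it is irreducible. It is aperiodic, unless $|A|\ge 2$, no two ambiguous vertices lie in the same block ($n_i-m_i\le 1$ for all $i$), and $\mathbb Q(\cdot\mid G)$ is constant on $\Phi$. 3. Let $(X_s)_{s\ge 0}$ be a Markov chain with transition matrix $\widehat P$ and $X_0$ uniform on $\Phi$. Almost surely, every state is visited infinitely often. Moreover, for every fixed $T\in\mathbb N$, almost surely, for every $v\in A$, $$\widehat{\mathbb Q}_t(v):=\frac{|\{s:T<s\le T+t,\ X_s(v)=1\}|}{t}\ \longrightarrow\ \mathbb Q(\phi(v)=1\mid G)\qquad(t\to\infty).$$ 4. Let a canonical list $\mathcal L^{C}$ be an ordering of $A$ in which each entry maximizes $\mathbb Q(\phi(v)=1\mid G)$ among the vertices not listed earlier, ties being broken arbitrarily, and let a canonical sampling list $\mathcal L^{CS}$ be defined in the same way with $\widehat{\mathbb Q}_t(v)$ in place of $\mathbb Q(\phi(v)=1\mid G)$. For every fixed $T$, almost surely, for all sufficiently large $t$ every canonical sampling list is a canonical list. In particular, if the numbers $\mathbb Q(\phi(v)=1\mid G)$, $v\in A$, are pairwise distinct, then almost surely, for all sufficiently large $t$,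 the canonical sampling list equals the canonical list. -/

import Mathlib

open Filter Topology MeasureTheory

namespace VertexNomination

noncomputable section

/-! ### The posterior of the block membership function

The vertex set is `V`, the seeds are `S`, the ambiguous vertices are `Sᶜ`, the blocks are indexed by
`Fin K`, and the block of interest (block number one) is `0 : Fin K`. -/

/-- The size `n_i` of block `i` under the block membership function `b`. -/
def blockSize {V : Type*} [Fintype V] {K : ℕ} (b : V → Fin K) (i : Fin K) : ℕ :=
  (Finset.univ.filter fun v => b v = i).card

/-- The number `m_i` of seeds in block `i`. -/
def seedSize {V : Type*} {K : ℕ} (S : Finset V) (b : V → Fin K) (i : Fin K) : ℕ :=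
  (S.filter fun v => b v = i).card

/-- The set `Φ` of block membership functions that agree with `b` on the seeds and have the same
block sizes as `b`. -/
abbrev Labeling {V : Type*} [Fintype V] {K : ℕ} (S : Finset V) (b : V → Fin K) : Type _ :=
  {φ : V → Fin K // (∀ v ∈ S, φ v = b v) ∧ ∀ i, blockSize φ i = blockSize b i}

/-- `e_{i,j}`: the number of edges of `G` with `φ`-label `i` at one end and `j` at the other. -/
def edgeCount {V : Type*} [Fintype V] [DecidableEq V] {K : ℕ} (G : SimpleGraph V)
    [DecidableRel G.Adj] (φ : V → Fin K) (i j : Fin K) : ℕ :=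
  (G.edgeFinset.filter fun e => e.map φ = s(i, j)).card

/-- `c_{i,j}`: the number of nonadjacent pairs with labels `i` and `j`, that is
`n_i n_j - e_{i,j}` for `i ≠ j` and `n_i.choose 2 - e_{i,i}` for `i = j` (never truncated). -/
def nonEdgeCount {V : Type*} [Fintype V] [DecidableEq V] {K : ℕ} (G : SimpleGraph V)
    [DecidableRel G.Adj] (φ : V → Fin K) (i j : Fin K) : ℕ :=
  (if i = j then (blockSize φ i).choose 2 else blockSize φ i * blockSize φ j)
    - edgeCount G φ i j

/-- The probability of `G` under the stochastic block model with block membership function `φ` and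
Bernoulli matrix `Λ`: the product over `i ≤ j` of `Λ_{i,j}^{e_{i,j}} (1 - Λ_{i,j})^{c_{i,j}}`. -/
def likelihood {V : Type*} [Fintype V] [DecidableEq V] {K : ℕ} (Λ : Matrix (Fin K) (Fin K) ℝ)
    (G : SimpleGraph V) [DecidableRel G.Adj] (φ : V → Fin K) : ℝ :=
  ∏ i, ∏ j ∈ Finset.Ici i,
    Λ i j ^ edgeCount G φ i j * (1 - Λ i j) ^ nonEdgeCount G φ i j

/-- The joint probability `Q(G, φ)`: `φ` is uniform on `Φ` and, given `φ`, the graph is drawn from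
the stochastic block model. The number of elements of `Φ` is the multinomial coefficient. -/
def joint {V : Type*} [Fintype V] [DecidableEq V] {K : ℕ} (S : Finset V) (b : V → Fin K)
    (Λ : Matrix (Fin K) (Fin K) ℝ) (G : SimpleGraph V) [DecidableRel G.Adj]
    (φ : Labeling S b) : ℝ :=
  1 / (Nat.multinomial Finset.univ fun i => blockSize b i - seedSize S b i : ℝ)
    * likelihood Λ G φ.1

/-- The posterior `Q(φ | G)`. -/
def posterior {V : Type*} [Fintype V] [DecidableEq V] {K : ℕ} (S : Finset V) (b : V → Fin K)
    (Λ : Matrix (Fin K) (Fin K) ℝ) (G : SimpleGraph V) [DecidableRel G.Adj]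
    (φ : Labeling S b) : ℝ :=
  joint S b Λ G φ / ∑ ψ : Labeling S b, joint S b Λ G ψ

/-- The posterior probability `Q(φ(v) = 1 | G)` that `v` lies in the block of interest. -/
def posteriorProb {V : Type*} [Fintype V] [DecidableEq V] {K : ℕ} [NeZero K] (S : Finset V)
    (b : V → Fin K) (Λ : Matrix (Fin K) (Fin K) ℝ) (G : SimpleGraph V) [DecidableRel G.Adj]
    (v : V) : ℝ :=
  ∑ φ : Labeling S b with φ.1 v = 0, posterior S b Λ G φ

/-! ### The base chain and the Metropolis–Hastings chain -/

/-- The one-step transition matrix of the Bernoulli–Laplace chain on `Φ`. Two elements of `Φ` at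
Hamming distance two differ by swapping the labels of two ambiguous vertices. -/
def baseChain {V : Type*} [Fintype V] [DecidableEq V] {K : ℕ} (S : Finset V) (b : V → Fin K) :
    Matrix (Labeling S b) (Labeling S b) ℝ :=
  fun φ φ' => (if hammingDist φ.1 φ'.1 = 2 then 1 else 0) /
    (((Sᶜ.card).choose 2 : ℝ) - ∑ i, ((blockSize b i - seedSize S b i).choose 2 : ℝ))

/-- The one-step transition matrix of the Metropolis–Hastings chain with the Bernoulli–Laplace base
chain and target `Q(· | G)`. -/
def mhChain {V : Type*} [Fintype V] [DecidableEq V] {K : ℕ} (S : Finset V) (b : V → Fin K)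
    (Λ : Matrix (Fin K) (Fin K) ℝ) (G : SimpleGraph V) [DecidableRel G.Adj] :
    Matrix (Labeling S b) (Labeling S b) ℝ :=
  let move : Labeling S b → Labeling S b → ℝ := fun φ φ' =>
    baseChain S b φ φ' * min 1 (likelihood Λ G φ'.1 / likelihood Λ G φ.1)
  fun φ φ' => if φ = φ' then 1 - ∑ ψ : Labeling S b with ψ ≠ φ, move φ ψ else move φ φ'

/-! ### Finite Markov chains -/

/-- Detailed balance of the transition matrix `P` with respect to `π`. -/
def IsReversible {E : Type*} (π : E → ℝ) (P : Matrix E E ℝ) : Prop :=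
  ∀ x y, π x * P x y = π y * P y x

/-- Every state has period one: the only common divisor of its possible return times is `1`. -/
def IsAperiodic {E : Type*} [Fintype E] [DecidableEq E] (P : Matrix E E ℝ) : Prop :=
  ∀ x, ∀ d : ℕ, (∀ n : ℕ, 0 < n → 0 < (P ^ n) x x → d ∣ n) → d = 1

/-- `X` is a Markov chain with initial distribution `ν` and transition matrix `P`, expressed through
its finite-dimensional distributions. -/
structure IsMarkovChain {Ω : Type*} [MeasurableSpace Ω] (μ : Measure Ω) {E : Type*}
    (ν : E → ℝ) (P : Matrix E E ℝ) (X : ℕ → Ω → E) : Prop where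
  measurableSet_fiber : ∀ s x, MeasurableSet {ω | X s ω = x}
  law : ∀ (t : ℕ) (x : ℕ → E),
    μ.real {ω | ∀ s ≤ t, X s ω = x s} = ν (x 0) * ∏ s ∈ Finset.range t, P (x s) (x (s + 1))

/-! ### Nomination lists -/

/-- The estimate of `Q(φ(v) = 1 | G)` along a trajectory `x` of the chain: the fraction of the times
`T < s ≤ T + t` at which `v` is labelled with the block of interest. -/
def empiricalProb {V : Type*} [Fintype V] {K : ℕ} [NeZero K] {S : Finset V} {b : V → Fin K}
    (x : ℕ → Labeling S b) (T t : ℕ) (v : V) : ℝ :=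
  ((Finset.Ioc T (T + t)).filter fun s => (x s).1 v = 0).card / (t : ℝ)

/-- `l` lists the elements of `A` greedily by decreasing score, ties being broken arbitrarily: each
entry maximizes the score among the vertices that are not listed earlier. -/
def IsNominationList {V : Type*} (A : Finset V) (score : V → ℝ) (l : Fin A.card ≃ A) : Prop :=
  ∀ i, ∀ v : A, (∀ j < i, l j ≠ v) → score v ≤ score (l i)

end

end VertexNomination

namespace VertexNomination

/-! ### Finite Markov chains -/

section FiniteMarkov

variable {E : Type*} [Fintype E] [DecidableEq E] {P : Matrix E E ℝ}

/-! The claims about the chain are combinatorial, the claims about its trajectories reduce to an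
ergodic theorem, and the claims about lists are a continuity argument.

Combinatorics: since block sizes are fixed, two labelings at Hamming distance two differ by a swap
of two ambiguous vertices, and any labeling can be moved towards any other by swaps
(`exists_swap_hammingDist_lt`). The number of such swaps is the same at every labeling
(`card_hammingDist_eq_two`), which makes the base chain stochastic. All likelihoods are positive, so
the Metropolis–Hastings chain inherits every swap and is irreducible; detailed balance is the
symmetry of `min`. For aperiodicity, two ambiguous vertices in one block give cycles of length two
and three, and a nonconstant posterior gives a swap that can be rejected, hence a positive holding
probability.

Ergodic theorem (`IsMarkovChain.tendsto_average`): solve the Poisson equation `f - p(f) = g - P g`.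
Then the centred sums of `f` along the chain are a sum of bounded orthogonal martingale differences
plus a bounded boundary term. A second moment bound along the squares, followed by monotone
interpolation, shows that the martingale part is `o(n)` almost surely. No aperiodicity enters.
Recurrence and the convergence of the empirical frequencies are the cases of indicator functions.

Lists: finitely many strict inequalities between limits eventually hold between the converging
scores, and a nomination list only depends on strict inequalities. -/

lemma pow_mulVec_of_harmonic {h : E → ℝ} (hh : P.mulVec h = h) (k : ℕ) :
    (P ^ k).mulVec h = h := by
  induction k with
  | zero => simp
  | succ k ih => rw [pow_succ, ← Matrix.mulVec_mulVec, hh, ih]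

/-- Harmonic functions of an irreducible stochastic matrix are constant. -/
lemma eq_of_harmonic (hP : P ∈ Matrix.rowStochastic ℝ E) (hirr : P.IsIrreducible)
    {h : E → ℝ} (hh : P.mulVec h = h) (x y : E) : h x = h y := by
  have : Nonempty E := ⟨x⟩
  obtain ⟨m, hm⟩ := Finite.exists_max h
  suffices H : ∀ y, h y = h m by rw [H x, H y]
  intro y
  obtain ⟨k, -, hk⟩ := (Matrix.isIrreducible_iff_exists_pow_pos hirr.nonneg).1 hirr m y
  have hPk := pow_mem hP k
  -- Maximum principle: the nonnegative gaps `h m - h z` have mean zero under row `m` of `P ^ k`, so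
  -- the gap vanishes wherever that row is positive.
  have hsum : ∑ z, (P ^ k) m z * (h m - h z) = 0 := by
    have h1 := congrFun (pow_mulVec_of_harmonic hh k) m
    simp only [Matrix.mulVec, dotProduct] at h1
    simp only [mul_sub, Finset.sum_sub_distrib, ← Finset.sum_mul,
      Matrix.sum_row_of_mem_rowStochastic hPk m, h1]
    ring
  have h0 := (Finset.sum_eq_zero_iff_of_nonneg (fun z _ =>
    mul_nonneg (Matrix.nonneg_of_mem_rowStochastic hPk) (sub_nonneg.2 (hm z)))).1 hsum y
      (Finset.mem_univ y)
  rcases mul_eq_zero.1 h0 with h2 | h2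
  · exact absurd h2 hk.ne'
  · linarith

/-- The Poisson equation of an irreducible stochastic matrix is solvable. -/
lemma exists_poisson_solution (hP : P ∈ Matrix.rowStochastic ℝ E) (hirr : P.IsIrreducible)
    {p : E → ℝ} (hp : ∑ x, p x = 1) (hstat : Matrix.vecMul p P = p) (f : E → ℝ) :
    ∃ g : E → ℝ, ∀ x, f x - ∑ y, p y * f y = g x - P.mulVec g x := by
  have hpP : ∀ g : E → ℝ, p ⬝ᵥ P.mulVec g = p ⬝ᵥ g := fun g => by
    rw [Matrix.dotProduct_mulVec, hstat]
  -- `I - P` is singular on constants; adding the rank-one map `g ↦ p(g)` makes it invertible. Since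
  -- `T` preserves the `p`-mean, a preimage of `f` solves the Poisson equation.
  let T : (E → ℝ) →ₗ[ℝ] (E → ℝ) :=
    { toFun := fun g x => g x - P.mulVec g x + p ⬝ᵥ g
      map_add' := fun g g' => by
        funext x
        simp only [Matrix.mulVec_add, dotProduct_add, Pi.add_apply]
        ring
      map_smul' := fun c g => by
        funext x
        simp only [Matrix.mulVec_smul, dotProduct_smul, Pi.smul_apply, smul_eq_mul,
          RingHom.id_apply]
        ring }
  have hpT : ∀ g, p ⬝ᵥ T g = p ⬝ᵥ g := fun g => by
    have hT : T g = g - P.mulVec g + (p ⬝ᵥ g) • (1 : E → ℝ) := by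
      funext x
      simp [T]
    have h1 : p ⬝ᵥ (1 : E → ℝ) = 1 := by simpa [dotProduct] using hp
    rw [hT, dotProduct_add, dotProduct_sub, hpP, dotProduct_smul, h1]
    simp
  -- A kernel element has `p`-mean zero, hence is harmonic, hence is constant and equal to its mean.
  have hinj : Function.Injective T := by
    rw [← LinearMap.ker_eq_bot, LinearMap.ker_eq_bot']
    intro g hg
    have hg0 : p ⬝ᵥ g = 0 := by rw [← hpT, hg, dotProduct_zero]
    have hharm : P.mulVec g = g := by
      funext x
      have := congrFun hg x
      simp only [T, LinearMap.coe_mk, AddHom.coe_mk, hg0, Pi.zero_apply] at this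
      linarith
    funext x
    have hx : p ⬝ᵥ g = g x := by
      simp only [dotProduct]
      rw [Finset.sum_congr rfl fun y _ => by rw [eq_of_harmonic hP hirr hharm y x],
        ← Finset.sum_mul, hp, one_mul]
    rw [← hx, hg0]
    rfl
  obtain ⟨g, hg⟩ := (LinearMap.injective_iff_surjective.1 hinj) f
  refine ⟨g, fun x => ?_⟩
  have h1 : p ⬝ᵥ f = p ⬝ᵥ g := by rw [← hg, hpT]
  have h2 : f x = g x - P.mulVec g x + p ⬝ᵥ g := congrFun hg.symm x
  change f x - p ⬝ᵥ f = _
  rw [h1, h2]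
  ring

lemma vecMul_eq_of_isReversible (hP : P ∈ Matrix.rowStochastic ℝ E) {p : E → ℝ}
    (hrev : IsReversible p P) : Matrix.vecMul p P = p := by
  funext y
  simp only [Matrix.vecMul, dotProduct]
  rw [Finset.sum_congr rfl fun x _ => hrev x y, ← Finset.mul_sum,
    Matrix.sum_row_of_mem_rowStochastic hP y, mul_one]

lemma pow_add_pos (hP : ∀ x y, 0 ≤ P x y) {m n : ℕ} {x y z : E} (hxy : 0 < (P ^ m) x y)
    (hyz : 0 < (P ^ n) y z) : 0 < (P ^ (m + n)) x z := by
  rw [pow_add, Matrix.mul_apply]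
  exact Finset.sum_pos' (fun w _ => mul_nonneg (Matrix.pow_apply_nonneg hP m x w)
    (Matrix.pow_apply_nonneg hP n w z)) ⟨y, Finset.mem_univ y, mul_pos hxy hyz⟩

/-- An irreducible nonnegative matrix with a positive diagonal entry is aperiodic. -/
lemma isAperiodic_of_diag_pos (hirr : P.IsIrreducible) {x : E} (hx : 0 < P x x) :
    IsAperiodic P := by
  intro y d hd
  have hpow := (Matrix.isIrreducible_iff_exists_pow_pos hirr.nonneg).1 hirr
  obtain ⟨k, hk, hyx⟩ := hpow y x
  obtain ⟨l, hl, hxy⟩ := hpow x y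
  -- Loops from `y` through `x`, with and without one step of waiting at `x`, have consecutive
  -- lengths.
  have h1 := hd (k + l) (by omega) (pow_add_pos hirr.nonneg hyx hxy)
  have h2 := hd (k + 1 + l) (by omega) (pow_add_pos hirr.nonneg
    (pow_add_pos hirr.nonneg hyx (by simpa using hx)) hxy)
  have h3 := (Nat.dvd_sub h2 h1)
  rw [show k + 1 + l - (k + l) = 1 by omega] at h3
  exact Nat.dvd_one.1 h3

end FiniteMarkov

/-! ### Martingale differences along a finite chain and the ergodic theorem. -/

section Ergodic

variable {Ω : Type*} [MeasurableSpace Ω] {μ : Measure Ω}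
  {E : Type*} {P : Matrix E E ℝ} {ν : E → ℝ} {X : ℕ → Ω → E}

lemma IsMarkovChain.measurable_comp [Finite E] (hX : IsMarkovChain μ ν P X) (g : E → ℝ) (s : ℕ) :
    Measurable fun ω => g (X s ω) := by
  let _ : MeasurableSpace E := ⊤
  exact (measurable_from_top (f := g)).comp (measurable_to_countable' (hX.measurableSet_fiber s))

lemma IsMarkovChain.measurableSet_cylinder (hX : IsMarkovChain μ ν P X) (r : ℕ) (x : ℕ → E) :
    MeasurableSet {ω | ∀ s ≤ r, X s ω = x s} := by
  simp only [Set.ofPred_forall]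
  exact MeasurableSet.iInter fun s => MeasurableSet.iInter fun _ => hX.measurableSet_fiber s (x s)

/-- The Markov property in product form, which avoids conditioning on cylinders of measure zero:
prolonging the path by `y` adds one factor to the law. -/
lemma IsMarkovChain.measureReal_cylinder_inter (hX : IsMarkovChain μ ν P X) (r : ℕ) (x : ℕ → E)
    (y : E) : μ.real ({ω | ∀ s ≤ r, X s ω = x s} ∩ {ω | X (r + 1) ω = y}) =
      μ.real {ω | ∀ s ≤ r, X s ω = x s} * P (x r) y := by
  have hset : {ω | ∀ s ≤ r, X s ω = x s} ∩ {ω | X (r + 1) ω = y} =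
      {ω | ∀ s ≤ r + 1, X s ω = Function.update x (r + 1) y s} := by
    ext ω
    simp only [Set.mem_inter_iff, Set.mem_ofPred_eq]
    constructor
    · rintro ⟨h1, h2⟩ s hs
      rcases Nat.le_succ_iff.1 hs with h | rfl
      · rw [Function.update_of_ne (by omega), h1 s h]
      · simpa using h2
    · intro h
      refine ⟨fun s hs => ?_, by simpa using h (r + 1) le_rfl⟩
      rw [h s (by omega), Function.update_of_ne (by omega)]
  rw [hset, hX.law, hX.law, Finset.prod_range_succ, Function.update_of_ne (by omega),
    Function.update_of_ne (by omega), Function.update_self, mul_assoc]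
  congr 2
  refine Finset.prod_congr rfl fun s hs => ?_
  have := Finset.mem_range.1 hs
  rw [Function.update_of_ne (by omega), Function.update_of_ne (by omega)]

variable [Fintype E]

/-- The martingale difference of `g` along the chain. -/
def increment {Ω : Type*} (P : Matrix E E ℝ) (g : E → ℝ) (X : ℕ → Ω → E) (s : ℕ) (ω : Ω) : ℝ :=
  g (X (s + 1) ω) - P.mulVec g (X s ω)

lemma IsMarkovChain.measurable_increment (hX : IsMarkovChain μ ν P X) (g : E → ℝ) (s : ℕ) :
    Measurable (increment P g X s) :=
  (hX.measurable_comp g (s + 1)).sub (hX.measurable_comp (P.mulVec g) s)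

lemma exists_increment_bound {Ω : Type*} (P : Matrix E E ℝ) (g : E → ℝ) (X : ℕ → Ω → E) :
    ∃ C : ℝ, 0 ≤ C ∧ ∀ s ω, |increment P g X s ω| ≤ C := by
  refine ⟨∑ z : E × E, |g z.1 - P.mulVec g z.2|, Finset.sum_nonneg fun _ _ => abs_nonneg _,
    fun s ω => ?_⟩
  exact Finset.single_le_sum (f := fun z : E × E => |g z.1 - P.mulVec g z.2|)
    (fun _ _ => abs_nonneg _) (Finset.mem_univ (X (s + 1) ω, X s ω))

variable [IsProbabilityMeasure μ]

/-- Once the path up to time `r` is frozen, the next state has weights `P (x r) ·`, so `g` at that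
state averages to `P.mulVec g (x r)`. -/
lemma IsMarkovChain.integral_cylinder_increment (hX : IsMarkovChain μ ν P X) (g : E → ℝ) (r : ℕ)
    (x : ℕ → E) : ∫ ω in {ω | ∀ s ≤ r, X s ω = x s}, increment P g X r ω ∂μ = 0 := by
  set A := {ω | ∀ s ≤ r, X s ω = x s} with hA
  have hAm : MeasurableSet A := hX.measurableSet_cylinder r x
  have h1 : ∀ ω ∈ A, increment P g X r ω =
      ∑ y, Set.indicator {ω | X (r + 1) ω = y} (fun _ => g y - P.mulVec g (x r)) ω := by
    intro ω hω
    rw [Finset.sum_eq_single (X (r + 1) ω)]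
    · simp [increment, hω r le_rfl]
    · intro y _ hy
      exact Set.indicator_of_notMem (s := {ω | X (r + 1) ω = y})
        (fun h => hy (Eq.symm h)) (fun _ => g y - P.mulVec g (x r))
    · simp
  rw [setIntegral_congr_fun hAm h1, integral_finsetSum]
  · have h2 : ∀ y, ∫ ω in A, Set.indicator {ω | X (r + 1) ω = y}
        (fun _ => g y - P.mulVec g (x r)) ω ∂μ =
        μ.real A * (P (x r) y * g y) - μ.real A * P (x r) y * P.mulVec g (x r) := by
      intro y
      rw [integral_indicator_const _ (hX.measurableSet_fiber _ _),
        measureReal_restrict_apply (hX.measurableSet_fiber _ _), Set.inter_comm,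
        hX.measureReal_cylinder_inter, smul_eq_mul]
      ring
    -- The row sum comes from partitioning `A` by the next state, so `P` need not be stochastic on
    -- rows that the chain never reaches.
    have h3 : ∑ y, μ.real A * P (x r) y = μ.real A := by
      calc ∑ y, μ.real A * P (x r) y
          = ∑ y, μ.real (A ∩ {ω | X (r + 1) ω = y}) :=
            Finset.sum_congr rfl fun y _ => (hX.measureReal_cylinder_inter r x y).symm
        _ = μ.real (⋃ y, A ∩ {ω | X (r + 1) ω = y}) := by
            rw [measureReal_iUnion_fintype]
            · intro y z hyz
              refine Set.disjoint_left.2 fun ω h h' => hyz ?_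
              exact h.2.symm.trans h'.2
            · exact fun y => hAm.inter (hX.measurableSet_fiber _ _)
        _ = μ.real A := by
            congr 1
            ext ω
            simp
    rw [Finset.sum_congr rfl fun y _ => h2 y, Finset.sum_sub_distrib, ← Finset.mul_sum,
      ← Finset.sum_mul, h3]
    simp [Matrix.mulVec, dotProduct]
  · intro y _
    exact ((integrable_const _).indicator (hX.measurableSet_fiber _ _)).restrict

/-- Martingale differences are orthogonal to functions of the past. -/
lemma IsMarkovChain.integral_mul_increment (hX : IsMarkovChain μ ν P X) (g : E → ℝ) (r : ℕ)
    (F : (ℕ → E) → ℝ) (hF : ∀ x y : ℕ → E, (∀ s ≤ r, x s = y s) → F x = F y) :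
    ∫ ω, F (fun s => X s ω) * increment P g X r ω ∂μ = 0 := by
  -- A word of length `r + 1` is prolonged by repeating its last letter. As `F` ignores times after
  -- `r`, it takes one value per word, and the integral splits over finitely many cylinders.
  let ext (q : Fin (r + 1) → E) (s : ℕ) : E := q ⟨min s r, by omega⟩
  have h1 : ∀ ω, F (fun s => X s ω) * increment P g X r ω = ∑ q : Fin (r + 1) → E,
      F (ext q) * Set.indicator {ω | ∀ s ≤ r, X s ω = ext q s} (increment P g X r) ω := by
    intro ω
    rw [Finset.sum_eq_single (fun i : Fin (r + 1) => X i ω)]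
    · have h2 : ∀ s ≤ r, X s ω = ext (fun i : Fin (r + 1) => X i ω) s := fun s hs => by
        simp [ext, min_eq_left hs]
      rw [Set.indicator_of_mem (by exact h2), hF _ _ h2]
    · intro q _ hq
      rw [Set.indicator_of_notMem, mul_zero]
      intro h
      apply hq
      funext i
      have h2 := h i (Nat.lt_succ_iff.1 i.2)
      rw [h2]
      simp [ext, min_eq_left (Nat.lt_succ_iff.1 i.2)]
    · simp
  obtain ⟨C, -, hC⟩ := exists_increment_bound P g X
  have hint : Integrable (increment P g X r) μ :=
    Integrable.of_bound (hX.measurable_increment g r).aestronglyMeasurable C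
      (Eventually.of_forall fun ω => hC r ω)
  simp_rw [h1]
  rw [integral_finsetSum]
  · refine Finset.sum_eq_zero fun q _ => ?_
    rw [integral_const_mul, integral_indicator (hX.measurableSet_cylinder _ _),
      hX.integral_cylinder_increment, mul_zero]
  · intro q _
    exact (hint.indicator (hX.measurableSet_cylinder _ _)).const_mul _

/-- By orthogonality the cross terms vanish, so the second moment grows only linearly. -/
lemma IsMarkovChain.integral_sq_sum_increment_le (hX : IsMarkovChain μ ν P X) (g : E → ℝ) {C : ℝ}
    (hC : ∀ s ω, |increment P g X s ω| ≤ C) (n : ℕ) :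
    ∫ ω, (∑ s ∈ Finset.range n, increment P g X s ω) ^ 2 ∂μ ≤ C ^ 2 * n := by
  have hmS : ∀ n, Measurable fun ω => ∑ s ∈ Finset.range n, increment P g X s ω := fun n =>
    Finset.measurable_sum _ fun s _ => hX.measurable_increment g s
  have hbS : ∀ n ω, |∑ s ∈ Finset.range n, increment P g X s ω| ≤ n * C := fun n ω => by
    refine (Finset.abs_sum_le_sum_abs _ _).trans ?_
    refine (Finset.sum_le_card_nsmul _ _ C fun s _ => hC s ω).trans ?_
    simp
  have hsq : ∀ {f : Ω → ℝ} {B : ℝ}, Measurable f → (∀ ω, |f ω| ≤ B) →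
      Integrable (fun ω => f ω ^ 2) μ := fun {f B} hf hB =>
    Integrable.of_bound (hf.pow_const 2).aestronglyMeasurable (B ^ 2)
      (Eventually.of_forall fun ω => by
        rw [Real.norm_eq_abs, abs_pow]
        exact pow_le_pow_left₀ (abs_nonneg _) (hB ω) 2)
  induction n with
  | zero => simp
  | succ n ih =>
    have hcross := hX.integral_mul_increment g n
      (fun x => ∑ s ∈ Finset.range n, (g (x (s + 1)) - P.mulVec g (x s))) (by
        intro x y hxy
        refine Finset.sum_congr rfl fun s hs => ?_
        have := Finset.mem_range.1 hs
        rw [hxy s (by omega), hxy (s + 1) (by omega)])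
    change ∫ ω, (∑ s ∈ Finset.range n, increment P g X s ω) * increment P g X n ω ∂μ = 0 at hcross
    have hi1 := hsq (hmS n) (hbS n)
    have hi2 := hsq (hX.measurable_increment g n) (hC n)
    have hi3 : Integrable (fun ω =>
        (∑ s ∈ Finset.range n, increment P g X s ω) * increment P g X n ω) μ :=
      Integrable.of_bound ((hmS n).mul (hX.measurable_increment g n)).aestronglyMeasurable
        (n * C * C) (Eventually.of_forall fun ω => by
          rw [Real.norm_eq_abs, abs_mul]
          exact mul_le_mul (hbS n ω) (hC n ω) (abs_nonneg _)
            ((abs_nonneg _).trans (hbS n ω)))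
    have hexp : ∀ ω, (∑ s ∈ Finset.range (n + 1), increment P g X s ω) ^ 2 =
        (∑ s ∈ Finset.range n, increment P g X s ω) ^ 2 +
        2 * ((∑ s ∈ Finset.range n, increment P g X s ω) * increment P g X n ω) +
        increment P g X n ω ^ 2 := fun ω => by
      rw [Finset.sum_range_succ]
      ring
    have hlast : ∫ ω, increment P g X n ω ^ 2 ∂μ ≤ C ^ 2 := by
      calc ∫ ω, increment P g X n ω ^ 2 ∂μ ≤ ∫ _, C ^ 2 ∂μ :=
            integral_mono hi2 (integrable_const _) fun ω => sq_le_sq' (abs_le.1 (hC n ω)).1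
              (abs_le.1 (hC n ω)).2
        _ = C ^ 2 := by simp
    simp_rw [hexp]
    rw [integral_add (by exact hi1.add (hi3.const_mul 2)) hi2,
      integral_add hi1 (hi3.const_mul 2), integral_const_mul, hcross]
    push_cast
    linarith

/-- Along `n = k ^ 2` the averages have second moment at most `C ^ 2 / k ^ 2`, which is summable.
Hence the series of their squares is almost surely finite and its terms tend to zero. -/
lemma IsMarkovChain.tendsto_sum_increment_sq_div (hX : IsMarkovChain μ ν P X) (g : E → ℝ) :
    ∀ᵐ ω ∂μ, Tendsto (fun k : ℕ => (∑ s ∈ Finset.range (k ^ 2), increment P g X s ω) /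
      ((k ^ 2 : ℕ) : ℝ)) atTop (𝓝 0) := by
  obtain ⟨C, hC0, hC⟩ := exists_increment_bound P g X
  set Y : ℕ → Ω → ℝ := fun k ω =>
    (∑ s ∈ Finset.range (k ^ 2), increment P g X s ω) / ((k ^ 2 : ℕ) : ℝ) with hY
  have hmY : ∀ k, Measurable (Y k) := fun k =>
    (Finset.measurable_sum _ fun s _ => hX.measurable_increment g s).div_const _
  have hle : ∀ k, ∫⁻ ω, ENNReal.ofReal (Y k ω ^ 2) ∂μ ≤
      ENNReal.ofReal (C ^ 2 * (1 / (k : ℝ) ^ 2)) := fun k => by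
    have hbY : ∀ ω, |Y k ω| ≤ C := fun ω => by
      rw [hY, abs_div, Nat.abs_cast]
      refine div_le_of_le_mul₀ (Nat.cast_nonneg _) hC0 ?_
      refine (Finset.abs_sum_le_sum_abs _ _).trans ?_
      refine (Finset.sum_le_card_nsmul _ _ C fun s _ => hC s ω).trans ?_
      simp [mul_comm]
    rw [← ofReal_integral_eq_lintegral_ofReal]
    · refine ENNReal.ofReal_le_ofReal ?_
      simp_rw [hY, div_pow]
      rw [integral_div]
      rcases Nat.eq_zero_or_pos k with rfl | hk
      · simp
      · have hk' : (0 : ℝ) < k := Nat.cast_pos.2 hk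
        rw [div_le_iff₀ (by positivity)]
        refine (hX.integral_sq_sum_increment_le g hC (k ^ 2)).trans (le_of_eq ?_)
        push_cast
        field_simp
    · exact Integrable.of_bound ((hmY k).pow_const 2).aestronglyMeasurable (C ^ 2)
        (Eventually.of_forall fun ω => by
          rw [Real.norm_eq_abs, abs_pow]
          exact pow_le_pow_left₀ (abs_nonneg _) (hbY ω) 2)
    · exact Eventually.of_forall fun ω => sq_nonneg _
  have hfin : ∫⁻ ω, ∑' k, ENNReal.ofReal (Y k ω ^ 2) ∂μ ≠ ⊤ := by
    rw [lintegral_tsum fun k => ((hmY k).pow_const 2).ennreal_ofReal.aemeasurable]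
    refine ne_top_of_le_ne_top ?_ (ENNReal.tsum_le_tsum hle)
    exact ((Real.summable_one_div_nat_pow.2 one_lt_two).mul_left (C ^ 2)).tsum_ofReal_ne_top
  have hae := ae_lt_top' (AEMeasurable.tsum fun k =>
    ((hmY k).pow_const 2).ennreal_ofReal.aemeasurable) hfin
  filter_upwards [hae] with ω hω
  have h1 := ENNReal.tendsto_atTop_zero_of_tsum_ne_top hω.ne
  have h2 := (ENNReal.tendsto_toReal ENNReal.zero_ne_top).comp h1
  have h3 : Tendsto (fun k => Y k ω ^ 2) atTop (𝓝 0) := by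
    refine h2.congr fun k => ?_
    simp [ENNReal.toReal_ofReal (sq_nonneg (Y k ω))]
  have h4 := h3.sqrt
  rw [Real.sqrt_zero] at h4
  simp_rw [Real.sqrt_sq_eq_abs] at h4
  exact (tendsto_zero_iff_abs_tendsto_zero _).2 h4

/-- The strong law of large numbers for the martingale differences. -/
lemma IsMarkovChain.tendsto_sum_increment_div (hX : IsMarkovChain μ ν P X) (g : E → ℝ) :
    ∀ᵐ ω ∂μ, Tendsto (fun n : ℕ => (∑ s ∈ Finset.range n, increment P g X s ω) / (n : ℝ))
      atTop (𝓝 0) := by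
  obtain ⟨C, hC0, hC⟩ := exists_increment_bound P g X
  filter_upwards [hX.tendsto_sum_increment_sq_div g] with ω hω
  set S : ℕ → ℝ := fun n => ∑ s ∈ Finset.range n, increment P g X s ω with hS
  have hadd : ∀ n : ℕ, n ≠ 0 → (S n + C * n) / n = S n / n + C := fun n hn => by
    have : (n : ℝ) ≠ 0 := Nat.cast_ne_zero.2 hn
    field_simp
  -- The drift `C * n` makes the partial sums monotone. Consecutive squares have ratio tending to
  -- one, so convergence along the squares then forces convergence along all `n`.
  have hmono : Monotone fun n : ℕ => S n + C * n := by
    refine monotone_nat_of_le_succ fun n => ?_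
    simp only [hS, Finset.sum_range_succ]
    push_cast
    linarith [(abs_le.1 (hC n ω)).1]
  have hlim := tendsto_div_of_monotone_of_exists_subseq_tendsto_div
    (fun n : ℕ => S n + C * n) C hmono (fun a ha => by
      refine ⟨fun k => k ^ 2, ?_, tendsto_pow_atTop two_ne_zero, ?_⟩
      · have h1 : Tendsto (fun k : ℕ => (1 + 1 / (k : ℝ)) ^ 2) atTop (𝓝 ((1 + 0) ^ 2)) :=
          (tendsto_const_nhds.add tendsto_one_div_atTop_nhds_zero_nat).pow 2
        rw [add_zero, one_pow] at h1
        filter_upwards [h1.eventually (gt_mem_nhds ha), eventually_gt_atTop 0] with k hk hk0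
        have hk' : (0 : ℝ) < k := Nat.cast_pos.2 hk0
        push_cast
        calc ((k : ℝ) + 1) ^ 2 = (1 + 1 / (k : ℝ)) ^ 2 * k ^ 2 := by field_simp
          _ ≤ a * k ^ 2 := mul_le_mul_of_nonneg_right hk.le (by positivity)
      · have h1 := hω.add_const C
        rw [zero_add] at h1
        refine h1.congr' ?_
        filter_upwards [eventually_gt_atTop 0] with k hk
        exact (hadd (k ^ 2) (pow_pos hk 2).ne').symm)
  have h2 := hlim.sub_const C
  rw [sub_self] at h2
  refine h2.congr' ?_
  filter_upwards [eventually_gt_atTop 0] with n hn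
  rw [hadd n hn.ne']
  ring

/-- The ergodic theorem for finite irreducible Markov chains. -/
theorem IsMarkovChain.tendsto_average [DecidableEq E] (hX : IsMarkovChain μ ν P X)
    (hP : P ∈ Matrix.rowStochastic ℝ E) (hirr : P.IsIrreducible)
    {p : E → ℝ} (hp : ∑ x, p x = 1) (hstat : Matrix.vecMul p P = p) (f : E → ℝ) :
    ∀ᵐ ω ∂μ, Tendsto (fun n : ℕ => (∑ s ∈ Finset.range n, f (X s ω)) / (n : ℝ)) atTop
      (𝓝 (∑ x, p x * f x)) := by
  obtain ⟨g, hg⟩ := exists_poisson_solution hP hirr hp hstat f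
  filter_upwards [hX.tendsto_sum_increment_div g] with ω hω
  -- By the Poisson equation, `f (X s)` minus its mean is the increment at `s` plus `g (X s) - g (X
  -- (s + 1))`, which telescopes.
  have hsum : ∀ n : ℕ, ∑ s ∈ Finset.range n, f (X s ω) =
      n * (∑ x, p x * f x) + ∑ s ∈ Finset.range n, increment P g X s ω +
        (g (X 0 ω) - g (X n ω)) := fun n => by
    induction n with
    | zero => simp
    | succ n ih =>
      rw [Finset.sum_range_succ, Finset.sum_range_succ, ih, increment]
      have := hg (X n ω)
      push_cast
      linarith
  have hbdd : Tendsto (fun n : ℕ => (g (X 0 ω) - g (X n ω)) / (n : ℝ)) atTop (𝓝 0) := by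
    have hB : ∀ n : ℕ, |g (X 0 ω) - g (X n ω)| ≤ 2 * ∑ x, |g x| := fun n => by
      have h1 : ∀ x, |g x| ≤ ∑ x, |g x| := fun x =>
        Finset.single_le_sum (f := fun x => |g x|) (fun _ _ => abs_nonneg _) (Finset.mem_univ x)
      linarith [abs_sub (g (X 0 ω)) (g (X n ω)), h1 (X 0 ω), h1 (X n ω)]
    refine squeeze_zero_norm (fun n => ?_)
      (tendsto_const_div_atTop_nhds_zero_nat (2 * ∑ x, |g x|))
    rw [norm_div, Real.norm_eq_abs, Real.norm_natCast]
    exact div_le_div_of_nonneg_right (hB n) (Nat.cast_nonneg n)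
  have h1 := ((tendsto_const_nhds (x := ∑ x, p x * f x)).add hω).add hbdd
  simp only [add_zero] at h1
  refine h1.congr' ?_
  filter_upwards [eventually_gt_atTop 0] with n hn
  have : (n : ℝ) ≠ 0 := Nat.cast_ne_zero.2 hn.ne'
  rw [hsum n]
  field_simp

end Ergodic

/-- A burn-in changes nothing in the limit: the `T + 1` discarded terms (index `0` included) have a
fixed sum, and `(t + T + 1) / t` tends to one. -/
lemma tendsto_average_shift {u : ℕ → ℝ} {l : ℝ}
    (hu : Tendsto (fun n : ℕ => (∑ s ∈ Finset.range n, u s) / (n : ℝ)) atTop (𝓝 l)) (T : ℕ) :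
    Tendsto (fun t : ℕ => (∑ s ∈ Finset.Ioc T (T + t), u s) / (t : ℝ)) atTop (𝓝 l) := by
  have hshift : Tendsto (fun t : ℕ => t + (T + 1)) atTop atTop := tendsto_add_atTop_nat _
  have h1 := hu.comp hshift
  have h2 : Tendsto (fun t : ℕ => (1 : ℝ) + ((T + 1 : ℕ) : ℝ) / (t : ℝ)) atTop (𝓝 (1 + 0)) :=
    tendsto_const_nhds.add (tendsto_const_div_atTop_nhds_zero_nat _)
  have h3 := (h1.mul h2).sub
    (tendsto_const_div_atTop_nhds_zero_nat (∑ s ∈ Finset.range (T + 1), u s))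
  rw [add_zero, mul_one, sub_zero] at h3
  refine h3.congr' ?_
  filter_upwards [eventually_gt_atTop 0] with t ht
  have ht' : (t : ℝ) ≠ 0 := Nat.cast_ne_zero.2 ht.ne'
  have ht2 : (t : ℝ) + (T + 1) ≠ 0 := by positivity
  have hsplit : ∑ s ∈ Finset.Ioc T (T + t), u s =
      ∑ s ∈ Finset.range (t + (T + 1)), u s - ∑ s ∈ Finset.range (T + 1), u s := by
    rw [← Finset.sum_Ico_eq_sub _ (by omega)]
    refine Finset.sum_congr ?_ fun _ _ => rfl
    ext s
    simp only [Finset.mem_Ioc, Finset.mem_Ico]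
    omega
  rw [hsplit]
  simp only [Function.comp]
  push_cast
  field_simp

/-! ### The Bernoulli–Laplace chain -/

section Swaps

variable {V : Type*} [Fintype V] {K : ℕ} {S : Finset V} {b : V → Fin K}

instance : Nonempty (Labeling S b) := ⟨⟨b, fun _ _ => rfl, fun _ => rfl⟩⟩

lemma blockSize_comp_perm (φ : V → Fin K) (σ : Equiv.Perm V) (i : Fin K) :
    blockSize (φ ∘ σ) i = blockSize φ i :=
  Finset.card_bij (fun v _ => σ v) (fun v hv => by simpa using hv)
    (fun _ _ _ _ h => σ.injective h)
    (fun v hv => ⟨σ.symm v, by simpa using hv, by simp⟩)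

/-- A label that is gained at `u` is lost at some other vertex. -/
lemma exists_label_lost (φ ψ : Labeling S b) {u : V} (hu : φ.1 u ≠ ψ.1 u) :
    ∃ w, φ.1 w = ψ.1 u ∧ ψ.1 w ≠ ψ.1 u := by
  by_contra! h
  -- If the label were lost nowhere, its `φ`-class would lie in its `ψ`-class; the sizes agree, so
  -- the classes would coincide, although `u` lies only in the second.
  have hsub : (Finset.univ.filter fun v => φ.1 v = ψ.1 u) ⊆
      Finset.univ.filter fun v => ψ.1 v = ψ.1 u := fun v hv => by
    simpa using h v (by simpa using hv)
  have heq := Finset.eq_of_subset_of_card_le hsub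
    (le_of_eq ((ψ.2.2 (ψ.1 u)).trans (φ.2.2 (ψ.1 u)).symm))
  have hmem : u ∈ Finset.univ.filter fun v => φ.1 v = ψ.1 u := heq ▸ by simp
  exact hu (by simpa using hmem)

lemma notMem_of_ne (φ ψ : Labeling S b) {u : V} (hu : φ.1 u ≠ ψ.1 u) : u ∉ S := fun h =>
  hu ((φ.2.1 u h).trans (ψ.2.1 u h).symm)

variable [DecidableEq V]

/-- The labeling obtained from `φ` by swapping the labels of two ambiguous vertices. -/
def swapLabeling (φ : Labeling S b) {u v : V} (hu : u ∉ S) (hv : v ∉ S) : Labeling S b :=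
  ⟨φ.1 ∘ Equiv.swap u v, fun w hw => by
      rw [Function.comp_apply, Equiv.swap_apply_of_ne_of_ne (ne_of_mem_of_not_mem hw hu)
        (ne_of_mem_of_not_mem hw hv), φ.2.1 w hw],
    fun i => (blockSize_comp_perm φ.1 (Equiv.swap u v) i).trans (φ.2.2 i)⟩

lemma filter_ne_comp_swap {φ : V → Fin K} {u v : V} (huv : φ u ≠ φ v) :
    (Finset.univ.filter fun w => φ w ≠ (φ ∘ Equiv.swap u v) w) = {u, v} := by
  ext w
  simp only [Finset.mem_filter, Finset.mem_univ, true_and, Finset.mem_insert,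
    Finset.mem_singleton, Function.comp_apply]
  rcases eq_or_ne w u with rfl | hwu
  · simpa using huv
  · rcases eq_or_ne w v with rfl | hwv
    · simpa using huv.symm
    · simp [Equiv.swap_apply_of_ne_of_ne hwu hwv, hwu, hwv]

lemma hammingDist_comp_swap {φ : V → Fin K} {u v : V} (huv : φ u ≠ φ v) :
    hammingDist φ (φ ∘ Equiv.swap u v) = 2 := by
  rw [hammingDist, filter_ne_comp_swap huv]
  exact Finset.card_pair fun h => huv (h ▸ rfl)

/-- With only two disagreements, the label gained at one of them can only have been lost at the
other. -/
lemma exists_swap_of_hammingDist_eq_two {φ ψ : Labeling S b} (h : hammingDist φ.1 ψ.1 = 2) :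
    ∃ u v, u ∉ S ∧ v ∉ S ∧ φ.1 u ≠ φ.1 v ∧ ψ.1 = φ.1 ∘ Equiv.swap u v := by
  obtain ⟨u, v, huv, hset⟩ := Finset.card_eq_two.1 h
  have hmem : ∀ w, φ.1 w ≠ ψ.1 w ↔ w = u ∨ w = v := fun w => by
    simpa using Finset.ext_iff.1 hset w
  have hu : φ.1 u ≠ ψ.1 u := (hmem u).2 (Or.inl rfl)
  have hv : φ.1 v ≠ ψ.1 v := (hmem v).2 (Or.inr rfl)
  have huv' : φ.1 v = ψ.1 u := by
    obtain ⟨w, hw1, hw2⟩ := exists_label_lost φ ψ hu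
    rcases (hmem w).1 (fun h => hw2 (h ▸ hw1)) with rfl | rfl
    · exact absurd rfl hw2
    · exact hw1
  have hvu' : φ.1 u = ψ.1 v := by
    obtain ⟨w, hw1, hw2⟩ := exists_label_lost φ ψ hv
    rcases (hmem w).1 (fun h => hw2 (h ▸ hw1)) with rfl | rfl
    · exact hw1
    · exact absurd rfl hw2
  refine ⟨u, v, notMem_of_ne φ ψ hu, notMem_of_ne φ ψ hv, huv' ▸ hu, ?_⟩
  funext w
  rw [Function.comp_apply]
  rcases eq_or_ne w u with rfl | hwu
  · simp [huv']
  · rcases eq_or_ne w v with rfl | hwv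
    · simp [hvu']
    · rw [Equiv.swap_apply_of_ne_of_ne hwu hwv]
      by_contra hne
      rcases (hmem w).1 (Ne.symm hne) with h | h
      · exact hwu h
      · exact hwv h

/-- Distinct labelings can be brought closer to each other by a swap. -/
lemma exists_swap_hammingDist_lt {φ ψ : Labeling S b} (h : φ ≠ ψ) :
    ∃ u v, ∃ (hu : u ∉ S) (hv : v ∉ S), φ.1 u ≠ φ.1 v ∧
      hammingDist (swapLabeling φ hu hv).1 ψ.1 < hammingDist φ.1 ψ.1 := by
  obtain ⟨u, hu⟩ : ∃ u, φ.1 u ≠ ψ.1 u := by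
    by_contra! h'
    exact h (Subtype.ext (funext h'))
  obtain ⟨w, hw1, hw2⟩ := exists_label_lost φ ψ hu
  have hw : φ.1 w ≠ ψ.1 w := fun h' => hw2 (h' ▸ hw1)
  -- The swap repairs `u`, and the other vertex it touches, `w`, was already a disagreement; so the
  -- set of disagreements strictly shrinks.
  refine ⟨u, w, notMem_of_ne φ ψ hu, notMem_of_ne φ ψ hw, hw1 ▸ hu, ?_⟩
  refine Finset.card_lt_card (Finset.ssubset_iff_of_subset (fun v hv => ?_) |>.2 ⟨u, ?_, ?_⟩)
  · have hv' : φ.1 (Equiv.swap u w v) ≠ ψ.1 v := (Finset.mem_filter.1 hv).2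
    refine Finset.mem_filter.2 ⟨Finset.mem_univ v, ?_⟩
    rcases eq_or_ne v u with rfl | hvu
    · exact hu
    · rcases eq_or_ne v w with rfl | hvw
      · exact hw
      · rwa [Equiv.swap_apply_of_ne_of_ne hvu hvw] at hv'
  · simpa using hu
  · intro h'
    have h'' : φ.1 (Equiv.swap u w u) ≠ ψ.1 u := (Finset.mem_filter.1 h').2
    exact h'' (by rw [Equiv.swap_apply_left, hw1])

lemma reflTransGen_hammingDist_eq_two (φ ψ : Labeling S b) :
    Relation.ReflTransGen (fun φ ψ : Labeling S b => hammingDist φ.1 ψ.1 = 2) φ ψ := by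
  induction hn : hammingDist φ.1 ψ.1 using Nat.strong_induction_on generalizing φ with
  | _ n ih =>
    rcases eq_or_ne φ ψ with rfl | hne
    · exact .refl
    · obtain ⟨u, v, hu, hv, huv, hlt⟩ := exists_swap_hammingDist_lt hne
      exact .head (hammingDist_comp_swap huv) (ih _ (hn ▸ hlt) _ rfl)

lemma card_filter_compl (φ : Labeling S b) (i : Fin K) :
    (Sᶜ.filter fun v => φ.1 v = i).card = blockSize b i - seedSize S b i := by
  have h1 : seedSize S b i = (S.filter fun v => φ.1 v = i).card :=
    congrArg Finset.card (Finset.filter_congr fun v hv => by rw [φ.2.1 v hv])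
  have h2 : blockSize φ.1 i =
      (S.filter fun v => φ.1 v = i).card + (Sᶜ.filter fun v => φ.1 v = i).card := by
    rw [← Finset.card_union_of_disjoint (Finset.disjoint_filter_filter disjoint_compl_right),
      ← Finset.filter_union, Finset.union_compl]
    rfl
  rw [← φ.2.2 i, h1, h2, Nat.add_sub_cancel_left]

/-- The number of swaps that change a labeling does not depend on the labeling. -/
lemma card_hammingDist_eq_two (φ : Labeling S b) :
    ((Finset.univ.filter fun ψ : Labeling S b => hammingDist φ.1 ψ.1 = 2).card : ℝ) =
      ((Sᶜ.card).choose 2 : ℝ) - ∑ i, ((blockSize b i - seedSize S b i).choose 2 : ℝ) := by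
  -- A neighbour of `φ` corresponds to its set of disagreements, which is an unordered pair of
  -- ambiguous vertices with different `φ`-labels.
  have hbij : (Finset.univ.filter fun ψ : Labeling S b => hammingDist φ.1 ψ.1 = 2).card =
      ((Finset.powersetCard 2 Sᶜ).filter fun p => ¬ ∀ u ∈ p, ∀ v ∈ p, φ.1 u = φ.1 v).card := by
    refine Finset.card_bij (fun ψ _ => Finset.univ.filter fun w => φ.1 w ≠ ψ.1 w) ?_ ?_ ?_
    · intro ψ hψ
      obtain ⟨u, v, hu, hv, huv, hψ'⟩ :=
        exists_swap_of_hammingDist_eq_two (Finset.mem_filter.1 hψ).2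
      rw [hψ', filter_ne_comp_swap huv, Finset.mem_filter, Finset.mem_powersetCard]
      refine ⟨⟨?_, Finset.card_pair fun h => huv (h ▸ rfl)⟩, fun h => huv ?_⟩
      · intro w hw
        rcases Finset.mem_insert.1 hw with rfl | hw
        · simpa using hu
        · simpa [Finset.mem_singleton.1 hw] using hv
      · exact h u (by simp) v (by simp)
    · intro ψ hψ ψ' hψ' heq
      obtain ⟨u, v, -, -, huv, h1⟩ :=
        exists_swap_of_hammingDist_eq_two (Finset.mem_filter.1 hψ).2
      obtain ⟨u', v', -, -, huv', h2⟩ :=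
        exists_swap_of_hammingDist_eq_two (Finset.mem_filter.1 hψ').2
      rw [h1, h2, filter_ne_comp_swap huv, filter_ne_comp_swap huv'] at heq
      refine Subtype.ext ?_
      rw [h1, h2]
      have hs : s(u, v) = s(u', v') := by
        have := Finset.coe_inj.2 heq
        simp only [Finset.coe_insert, Finset.coe_singleton] at this
        rcases Set.pair_eq_pair_iff.1 this with ⟨rfl, rfl⟩ | ⟨rfl, rfl⟩
        · rfl
        · exact Sym2.eq_swap
      rcases Sym2.eq_iff.1 hs with ⟨rfl, rfl⟩ | ⟨rfl, rfl⟩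
      · rfl
      · rw [Equiv.swap_comm]
    · intro p hp
      obtain ⟨hp1, hp2⟩ := Finset.mem_filter.1 hp
      obtain ⟨hsub, hcard⟩ := Finset.mem_powersetCard.1 hp1
      push Not at hp2
      obtain ⟨u, hup, v, hvp, huv⟩ := hp2
      have hu : u ∉ S := Finset.mem_compl.1 (hsub hup)
      have hv : v ∉ S := Finset.mem_compl.1 (hsub hvp)
      refine ⟨swapLabeling φ hu hv, ?_, ?_⟩
      · exact Finset.mem_filter.2 ⟨Finset.mem_univ _, hammingDist_comp_swap huv⟩
      · refine (filter_ne_comp_swap huv).trans (Finset.eq_of_subset_of_card_le ?_ ?_)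
        · intro w hw
          rcases Finset.mem_insert.1 hw with rfl | hw
          · exact hup
          · rwa [Finset.mem_singleton.1 hw]
        · rw [hcard, Finset.card_pair (ne_of_apply_ne φ.1 huv)]
  -- The complementary pairs, with equal labels, are counted block by block.
  have hmono : ((Finset.powersetCard 2 Sᶜ).filter fun p => ∀ u ∈ p, ∀ v ∈ p, φ.1 u = φ.1 v).card =
      ∑ i, (blockSize b i - seedSize S b i).choose 2 := by
    have hU : ((Finset.powersetCard 2 Sᶜ).filter fun p => ∀ u ∈ p, ∀ v ∈ p, φ.1 u = φ.1 v) =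
        Finset.univ.biUnion fun i => Finset.powersetCard 2 (Sᶜ.filter fun v => φ.1 v = i) := by
      ext p
      simp only [Finset.mem_filter, Finset.mem_powersetCard, Finset.mem_biUnion, Finset.mem_univ,
        true_and]
      constructor
      · rintro ⟨⟨hsub, hcard⟩, hp⟩
        obtain ⟨u, hu⟩ : p.Nonempty := Finset.card_pos.1 (by omega)
        exact ⟨φ.1 u, fun v hv => Finset.mem_filter.2 ⟨hsub hv, hp v hv u hu⟩, hcard⟩
      · rintro ⟨i, hsub, hcard⟩
        refine ⟨⟨fun v hv => (Finset.mem_filter.1 (hsub hv)).1, hcard⟩, fun u hu v hv => ?_⟩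
        rw [(Finset.mem_filter.1 (hsub hu)).2, (Finset.mem_filter.1 (hsub hv)).2]
    rw [hU, Finset.card_biUnion]
    · simp [Finset.card_powersetCard, card_filter_compl]
    · intro i _ j _ hij
      refine Finset.disjoint_left.2 fun p hp hp' => hij ?_
      obtain ⟨hsub, hcard⟩ := Finset.mem_powersetCard.1 hp
      obtain ⟨hsub', -⟩ := Finset.mem_powersetCard.1 hp'
      obtain ⟨u, hu⟩ : p.Nonempty := Finset.card_pos.1 (by omega)
      rw [← (Finset.mem_filter.1 (hsub hu)).2, (Finset.mem_filter.1 (hsub' hu)).2]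
  have htot := Finset.card_filter_add_card_filter_not (s := Finset.powersetCard 2 Sᶜ)
    (fun p => ∀ u ∈ p, ∀ v ∈ p, φ.1 u = φ.1 v)
  rw [hmono, ← hbij, Finset.card_powersetCard] at htot
  rw [← htot]
  push_cast
  ring

/-- With the normalizing constant recognized as the number of neighbours, nonnegativity and the row
sums are immediate. -/
lemma baseChain_apply (φ ψ : Labeling S b) : baseChain S b φ ψ =
    (if hammingDist φ.1 ψ.1 = 2 then 1 else 0) /
      ((Finset.univ.filter fun ψ : Labeling S b => hammingDist φ.1 ψ.1 = 2).card : ℝ) := by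
  rw [card_hammingDist_eq_two]
  rfl

lemma baseChain_nonneg (φ ψ : Labeling S b) : 0 ≤ baseChain S b φ ψ := by
  rw [baseChain_apply]
  positivity

lemma baseChain_pos {φ ψ : Labeling S b} (h : hammingDist φ.1 ψ.1 = 2) :
    0 < baseChain S b φ ψ := by
  rw [baseChain_apply, if_pos h]
  exact one_div_pos.2 (Nat.cast_pos.2 (Finset.card_pos.2 ⟨ψ, by simpa using h⟩))

lemma baseChain_symm (φ ψ : Labeling S b) : baseChain S b φ ψ = baseChain S b ψ φ := by
  simp only [baseChain, hammingDist_comm]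

lemma sum_baseChain (φ : Labeling S b) : ∑ ψ, baseChain S b φ ψ =
    ((Finset.univ.filter fun ψ : Labeling S b => hammingDist φ.1 ψ.1 = 2).card : ℝ) /
      ((Finset.univ.filter fun ψ : Labeling S b => hammingDist φ.1 ψ.1 = 2).card : ℝ) := by
  simp_rw [baseChain_apply]
  rw [← Finset.sum_div, Finset.sum_boole]

lemma sum_baseChain_le_one (φ : Labeling S b) : ∑ ψ, baseChain S b φ ψ ≤ 1 := by
  rw [sum_baseChain]
  -- If there are no neighbours, the row sum is `0 / 0 = 0`; the bound thus covers a one-element `Φ`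
  -- too.
  exact div_self_le_one _

lemma exists_swap_of_nontrivial [Nontrivial (Labeling S b)] (φ : Labeling S b) :
    ∃ u v, u ∉ S ∧ v ∉ S ∧ φ.1 u ≠ φ.1 v := by
  obtain ⟨ψ, hψ⟩ := exists_ne φ
  obtain ⟨u, v, hu, hv, huv, -⟩ := exists_swap_hammingDist_lt hψ.symm
  exact ⟨u, v, hu, hv, huv⟩

lemma baseChain_mem_rowStochastic [Nontrivial (Labeling S b)] :
    baseChain S b ∈ Matrix.rowStochastic ℝ (Labeling S b) := by
  refine Matrix.mem_rowStochastic_iff_sum.2 ⟨baseChain_nonneg, fun φ => ?_⟩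
  obtain ⟨u, v, hu, hv, huv⟩ := exists_swap_of_nontrivial φ
  rw [sum_baseChain]
  refine div_self (Nat.cast_ne_zero.2 (Finset.card_pos.2 ⟨swapLabeling φ hu hv, ?_⟩).ne')
  exact Finset.mem_filter.2 ⟨Finset.mem_univ _, hammingDist_comp_swap huv⟩

end Swaps

/-! ### The posterior and the Metropolis–Hastings chain -/

section MetropolisHastings

variable {V : Type*} [Fintype V] [DecidableEq V] {K : ℕ} {S : Finset V} {b : V → Fin K}
  {Λ : Matrix (Fin K) (Fin K) ℝ} {G : SimpleGraph V} [DecidableRel G.Adj]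

lemma likelihood_pos (hΛ : ∀ i j, Λ i j ∈ Set.Ioo (0 : ℝ) 1) (φ : V → Fin K) :
    0 < likelihood Λ G φ :=
  Finset.prod_pos fun i _ => Finset.prod_pos fun j _ =>
    mul_pos (pow_pos (hΛ i j).1 _) (pow_pos (sub_pos.2 (hΛ i j).2) _)

/-- The uniform prior cancels; only the positivity of the multinomial coefficient matters. -/
lemma posterior_eq (φ : Labeling S b) : posterior S b Λ G φ =
    likelihood Λ G φ.1 / ∑ ψ : Labeling S b, likelihood Λ G ψ.1 := by
  simp only [posterior, joint]
  rw [← Finset.mul_sum, mul_div_mul_left]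
  exact one_div_ne_zero (Nat.cast_ne_zero.2 (Nat.multinomial_pos _ _).ne')

lemma sum_likelihood_pos (hΛ : ∀ i j, Λ i j ∈ Set.Ioo (0 : ℝ) 1) :
    0 < ∑ ψ : Labeling S b, likelihood Λ G ψ.1 :=
  Finset.sum_pos (fun ψ _ => likelihood_pos hΛ ψ.1) Finset.univ_nonempty

lemma posterior_pos (hΛ : ∀ i j, Λ i j ∈ Set.Ioo (0 : ℝ) 1) (φ : Labeling S b) :
    0 < posterior S b Λ G φ := by
  rw [posterior_eq]
  exact div_pos (likelihood_pos hΛ φ.1) (sum_likelihood_pos hΛ)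

lemma sum_posterior (hΛ : ∀ i j, Λ i j ∈ Set.Ioo (0 : ℝ) 1) :
    ∑ φ, posterior S b Λ G φ = 1 := by
  simp_rw [posterior_eq]
  rw [← Finset.sum_div, div_self (sum_likelihood_pos hΛ).ne']

lemma mhChain_of_ne {φ ψ : Labeling S b} (h : φ ≠ ψ) : mhChain S b Λ G φ ψ =
    baseChain S b φ ψ * min 1 (likelihood Λ G ψ.1 / likelihood Λ G φ.1) := if_neg h

lemma mhChain_self (φ : Labeling S b) : mhChain S b Λ G φ φ =
    1 - ∑ ψ : Labeling S b with ψ ≠ φ,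
      baseChain S b φ ψ * min 1 (likelihood Λ G ψ.1 / likelihood Λ G φ.1) := if_pos rfl

lemma sum_filter_ne_baseChain_le_one (φ : Labeling S b) :
    ∑ ψ : Labeling S b with ψ ≠ φ, baseChain S b φ ψ ≤ 1 :=
  (Finset.sum_le_sum_of_subset_of_nonneg (Finset.filter_subset _ _)
    fun ψ _ _ => baseChain_nonneg φ ψ).trans (sum_baseChain_le_one φ)

lemma mhChain_mem_rowStochastic (hΛ : ∀ i j, Λ i j ∈ Set.Ioo (0 : ℝ) 1) :
    mhChain S b Λ G ∈ Matrix.rowStochastic ℝ (Labeling S b) := by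
  refine Matrix.mem_rowStochastic_iff_sum.2 ⟨fun φ ψ => ?_, fun φ => ?_⟩
  · rcases eq_or_ne φ ψ with rfl | h
    · rw [mhChain_self, sub_nonneg]
      refine le_trans (Finset.sum_le_sum fun ψ _ => ?_) (sum_filter_ne_baseChain_le_one φ)
      exact mul_le_of_le_one_right (baseChain_nonneg φ ψ) (min_le_left _ _)
    · rw [mhChain_of_ne h]
      exact mul_nonneg (baseChain_nonneg φ ψ) (le_min zero_le_one
        (div_pos (likelihood_pos hΛ ψ.1) (likelihood_pos hΛ φ.1)).le)
  · rw [← Finset.add_sum_erase _ _ (Finset.mem_univ φ), mhChain_self,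
      ← Finset.filter_ne' Finset.univ φ]
    rw [Finset.sum_congr rfl fun ψ hψ => mhChain_of_ne (Λ := Λ) (G := G)
      (Ne.symm (Finset.mem_filter.1 hψ).2)]
    ring

lemma mhChain_pos (hΛ : ∀ i j, Λ i j ∈ Set.Ioo (0 : ℝ) 1) {φ ψ : Labeling S b}
    (h : hammingDist φ.1 ψ.1 = 2) : 0 < mhChain S b Λ G φ ψ := by
  rw [mhChain_of_ne (fun h' => by simp [h'] at h)]
  exact mul_pos (baseChain_pos h) (lt_min one_pos
    (div_pos (likelihood_pos hΛ ψ.1) (likelihood_pos hΛ φ.1)))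

lemma isReversible_mhChain (hΛ : ∀ i j, Λ i j ∈ Set.Ioo (0 : ℝ) 1) :
    IsReversible (posterior S b Λ G) (mhChain S b Λ G) := by
  intro φ ψ
  rcases eq_or_ne φ ψ with rfl | h
  · rfl
  · have key : ∀ x y : ℝ, 0 < x → x * min 1 (y / x) = min x y := fun x y hx => by
      rw [mul_min_of_nonneg _ _ hx.le, mul_one, mul_div_cancel₀ _ hx.ne']
    have h1 := key _ (likelihood Λ G ψ.1) (likelihood_pos (G := G) hΛ φ.1)
    have h2 := key _ (likelihood Λ G φ.1) (likelihood_pos (G := G) hΛ ψ.1)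
    rw [min_comm (likelihood Λ G ψ.1)] at h2
    rw [mhChain_of_ne h, mhChain_of_ne h.symm, posterior_eq, posterior_eq, baseChain_symm ψ φ,
      div_mul_eq_mul_div, div_mul_eq_mul_div, mul_left_comm, h1, mul_left_comm, h2]

lemma mhChain_self_pos_of_subsingleton (hΛ : ∀ i j, Λ i j ∈ Set.Ioo (0 : ℝ) 1)
    [Subsingleton (Labeling S b)] (φ : Labeling S b) : 0 < mhChain S b Λ G φ φ := by
  have h := Matrix.sum_row_of_mem_rowStochastic
    (mhChain_mem_rowStochastic (S := S) (b := b) (G := G) hΛ) φ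
  rw [Fintype.sum_subsingleton _ φ] at h
  rw [h]
  exact one_pos

/-- Every swap is accepted with positive probability, and swaps connect `Φ`. -/
lemma isIrreducible_mhChain (hΛ : ∀ i j, Λ i j ∈ Set.Ioo (0 : ℝ) 1) :
    (mhChain S b Λ G).IsIrreducible := by
  have hnn : ∀ φ ψ, 0 ≤ mhChain S b Λ G φ ψ := fun φ ψ =>
    Matrix.nonneg_of_mem_rowStochastic (mhChain_mem_rowStochastic hΛ)
  rw [Matrix.isIrreducible_iff_exists_pow_pos hnn]
  have hpath : ∀ φ ψ, ∃ k, 0 < (mhChain S b Λ G ^ k) φ ψ := fun φ ψ => by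
    induction reflTransGen_hammingDist_eq_two φ ψ with
    | refl => exact ⟨0, by simp⟩
    | tail _ h ih =>
      obtain ⟨k, hk⟩ := ih
      exact ⟨k + 1, pow_add_pos hnn hk (by simpa using mhChain_pos hΛ h)⟩
  have hne : ∀ φ ψ, φ ≠ ψ → ∃ k > 0, 0 < (mhChain S b Λ G ^ k) φ ψ := fun φ ψ h => by
    obtain ⟨k, hk⟩ := hpath φ ψ
    refine ⟨k, Nat.pos_of_ne_zero fun h0 => ?_, hk⟩
    subst h0
    simp [h] at hk
  intro φ ψ
  rcases subsingleton_or_nontrivial (Labeling S b) with hs | hs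
  · refine ⟨1, one_pos, ?_⟩
    rw [pow_one, Subsingleton.elim ψ φ]
    exact mhChain_self_pos_of_subsingleton hΛ φ
  · rcases eq_or_ne φ ψ with rfl | h
    -- A return needs a positive number of steps and the holding probability may vanish, so the path
    -- makes a detour through another state.
    · obtain ⟨χ, hχ⟩ := exists_ne φ
      obtain ⟨k, hk, h1⟩ := hne φ χ hχ.symm
      obtain ⟨l, -, h2⟩ := hne χ φ hχ
      exact ⟨k + l, by omega, pow_add_pos hnn h1 h2⟩
    · exact hne φ ψ h

/-- A labeling from which a swap can be rejected has a positive holding probability. -/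
lemma mhChain_self_pos_of_likelihood_lt (hΛ : ∀ i j, Λ i j ∈ Set.Ioo (0 : ℝ) 1)
    {φ ψ : Labeling S b} (h : hammingDist φ.1 ψ.1 = 2)
    (hlt : likelihood Λ G ψ.1 < likelihood Λ G φ.1) : 0 < mhChain S b Λ G φ φ := by
  rw [mhChain_self, sub_pos]
  refine lt_of_lt_of_le (Finset.sum_lt_sum (fun χ _ => ?_) ⟨ψ, ?_, ?_⟩)
    (sum_filter_ne_baseChain_le_one φ)
  · exact mul_le_of_le_one_right (baseChain_nonneg φ χ) (min_le_left _ _)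
  · simp only [Finset.mem_filter, Finset.mem_univ, true_and]
    rintro rfl
    simp at h
  · exact mul_lt_of_lt_one_right (baseChain_pos h)
      (min_lt_of_right_lt ((div_lt_one (likelihood_pos hΛ φ.1)).2 hlt))

/-- If no swap changed the likelihood, it would be constant, because swaps connect `Φ`. -/
lemma exists_likelihood_lt (hconst : ¬ ∀ φ ψ : Labeling S b,
      posterior S b Λ G φ = posterior S b Λ G ψ) :
    ∃ φ ψ : Labeling S b, hammingDist φ.1 ψ.1 = 2 ∧
      likelihood Λ G ψ.1 < likelihood Λ G φ.1 := by
  by_contra! h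
  have heq : ∀ φ ψ : Labeling S b, likelihood Λ G φ.1 = likelihood Λ G ψ.1 := fun φ ψ => by
    induction reflTransGen_hammingDist_eq_two φ ψ with
    | refl => rfl
    | tail _ h' ih =>
      exact ih.trans (le_antisymm (h _ _ h') (h _ _ (by rwa [hammingDist_comm])))
  exact hconst fun φ ψ => by rw [posterior_eq, posterior_eq, heq φ ψ]

/-- Two ambiguous vertices in one block give rise to cycles of length three. -/
lemma isAperiodic_mhChain_of_two_le (hΛ : ∀ i j, Λ i j ∈ Set.Ioo (0 : ℝ) 1)
    [Nontrivial (Labeling S b)] {i : Fin K} (hi : 2 ≤ blockSize b i - seedSize S b i) :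
    IsAperiodic (mhChain S b Λ G) := by
  intro φ d hd
  have hnn : ∀ φ ψ, 0 ≤ mhChain S b Λ G φ ψ := fun φ ψ =>
    Matrix.nonneg_of_mem_rowStochastic (mhChain_mem_rowStochastic hΛ)
  rw [← card_filter_compl φ i] at hi
  obtain ⟨u, hu, v, hv, huv⟩ := Finset.one_lt_card.1 hi
  simp only [Finset.mem_filter, Finset.mem_compl] at hu hv
  obtain ⟨w, hw, hwi⟩ : ∃ w, w ∉ S ∧ φ.1 w ≠ i := by
    obtain ⟨x, y, hx, hy, hxy⟩ := exists_swap_of_nontrivial φ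
    by_cases h : φ.1 x = i
    · exact ⟨y, hy, fun h' => hxy (h.trans h'.symm)⟩
    · exact ⟨x, hx, h⟩
  have huw : u ≠ w := fun h => hwi (h ▸ hu.2)
  have hvw : v ≠ w := fun h => hwi (h ▸ hv.2)
  -- The label of `w` can sit at `w`, `u` or `v`, with `i` at the other two. These three labelings
  -- are pairwise one swap apart, which gives return times two and three.
  set φ₁ := swapLabeling φ hu.1 hw with hφ₁
  set φ₂ := swapLabeling φ hv.1 hw with hφ₂
  have h01 : hammingDist φ.1 φ₁.1 = 2 := hammingDist_comp_swap (by rw [hu.2]; exact hwi.symm)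
  have h02 : hammingDist φ.1 φ₂.1 = 2 := hammingDist_comp_swap (by rw [hv.2]; exact hwi.symm)
  have h12 : hammingDist φ₁.1 φ₂.1 = 2 := by
    have hu1 : φ₁.1 u = φ.1 w := by simp [hφ₁, swapLabeling]
    have hv1 : φ₁.1 v = i := by
      simp [hφ₁, swapLabeling, Equiv.swap_apply_of_ne_of_ne huv.symm hvw, hv.2]
    have heq : φ₂.1 = φ₁.1 ∘ Equiv.swap u v := by
      funext x
      rw [Function.comp_apply]
      rcases eq_or_ne x u with rfl | hxu
      · rw [Equiv.swap_apply_left, hv1]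
        simp [hφ₂, swapLabeling, Equiv.swap_apply_of_ne_of_ne huv huw, hu.2]
      · rcases eq_or_ne x v with rfl | hxv
        · rw [Equiv.swap_apply_right, hu1]
          simp [hφ₂, swapLabeling]
        · rw [Equiv.swap_apply_of_ne_of_ne hxu hxv]
          rcases eq_or_ne x w with rfl | hxw
          · simp [hφ₁, hφ₂, swapLabeling, hu.2, hv.2]
          · simp [hφ₁, hφ₂, swapLabeling, Equiv.swap_apply_of_ne_of_ne hxu hxw,
              Equiv.swap_apply_of_ne_of_ne hxv hxw]
    rw [heq]
    exact hammingDist_comp_swap (by rw [hu1, hv1]; exact hwi)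
  have hstep : ∀ {χ ψ : Labeling S b}, hammingDist χ.1 ψ.1 = 2 →
      0 < (mhChain S b Λ G ^ 1) χ ψ := fun h => by simpa using mhChain_pos hΛ h
  have hd2 := hd (1 + 1) (by omega)
    (pow_add_pos hnn (hstep h01) (hstep (by rwa [hammingDist_comm])))
  have hd3 := hd (1 + 1 + 1) (by omega) (pow_add_pos hnn (pow_add_pos hnn (hstep h01) (hstep h12))
    (hstep (by rwa [hammingDist_comm])))
  exact Nat.dvd_one.1 (by simpa using Nat.dvd_sub hd3 hd2)

lemma isAperiodic_mhChain (hΛ : ∀ i j, Λ i j ∈ Set.Ioo (0 : ℝ) 1)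
    (h : ¬ (2 ≤ Sᶜ.card ∧ (∀ i, blockSize b i - seedSize S b i ≤ 1) ∧
      ∀ φ ψ, posterior S b Λ G φ = posterior S b Λ G ψ)) :
    IsAperiodic (mhChain S b Λ G) := by
  rcases subsingleton_or_nontrivial (Labeling S b) with hs | hs
  · exact isAperiodic_of_diag_pos (isIrreducible_mhChain hΛ)
      (mhChain_self_pos_of_subsingleton hΛ (Classical.arbitrary _))
  · by_cases hblock : ∀ i, blockSize b i - seedSize S b i ≤ 1
    -- Two labelings can only differ if there are two ambiguous vertices; so the excluded case fails
    -- through a nonconstant posterior, and some swap can be rejected.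
    · have hA : 2 ≤ Sᶜ.card := by
        obtain ⟨u, v, hu, hv, huv⟩ := exists_swap_of_nontrivial (Classical.arbitrary (Labeling S b))
        exact Finset.one_lt_card.2 ⟨u, by simpa using hu, v, by simpa using hv,
          fun h' => huv (h' ▸ rfl)⟩
      obtain ⟨φ, ψ, hφψ, hlt⟩ := exists_likelihood_lt fun hc => h ⟨hA, hblock, hc⟩
      exact isAperiodic_of_diag_pos (isIrreducible_mhChain hΛ)
        (mhChain_self_pos_of_likelihood_lt hΛ hφψ hlt)
    · push Not at hblock
      obtain ⟨i, hi⟩ := hblock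
      exact isAperiodic_mhChain_of_two_le hΛ hi

end MetropolisHastings

/-! ### Nomination lists -/

section NominationLists

variable {V : Type*} {A : Finset V}

/-- Only a strictly better unlisted vertex can violate greediness, so a list survives the passage to
a score with fewer strict inequalities. -/
lemma IsNominationList.of_lt_imp_lt {score score' : V → ℝ} {l : Fin A.card ≃ A}
    (hl : IsNominationList A score l)
    (h : ∀ v ∈ A, ∀ w ∈ A, score' v < score' w → score v < score w) :
    IsNominationList A score' l := by
  intro i v hv
  by_contra! hlt
  exact absurd (hl i v hv) (not_le.2 (h _ (l i).2 _ v.2 hlt))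

/-- A score without ties has only one nomination list. -/
lemma IsNominationList.unique {score : V → ℝ} (hinj : Set.InjOn score A) {l l' : Fin A.card ≃ A}
    (hl : IsNominationList A score l) (hl' : IsNominationList A score l') : l = l' := by
  refine Equiv.ext fun i => ?_
  induction i using WellFoundedLT.induction with
  | _ i ih =>
    -- As the lists agree before `i`, each one's entry at `i` is still available to the other; both
    -- maximize, so their scores agree.
    have h1 := hl i (l' i) fun j hj h => hj.ne (l'.injective ((ih j hj).symm.trans h))
    have h2 := hl' i (l i) fun j hj h => hj.ne (l.injective ((ih j hj).trans h))
    exact Subtype.ext (hinj (l i).2 (l' i).2 (le_antisymm h2 h1))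

/-- Converging scores eventually order the vertices as their limits do, up to ties in the limit. -/
lemma eventually_isNominationList {s : ℕ → V → ℝ} {score : V → ℝ}
    (hs : ∀ v ∈ A, Tendsto (fun t => s t v) atTop (𝓝 (score v))) :
    ∀ᶠ t in atTop, ∀ l : Fin A.card ≃ A, IsNominationList A (s t) l →
      IsNominationList A score l := by
  -- `A` is finite, so one `t` serves all pairs; pairs tied in the limit impose nothing.
  have h : ∀ᶠ t in atTop, ∀ v ∈ A, ∀ w ∈ A, score v < score w → s t v < s t w := by
    refine (eventually_all_finset A).2 fun v hv => (eventually_all_finset A).2 fun w hw => ?_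
    by_cases hlt : score v < score w
    · filter_upwards [(hs v hv).eventually_lt (hs w hw) hlt] with t ht _ using ht
    · exact Eventually.of_forall fun t h' => absurd h' hlt
  filter_upwards [h] with t ht l hl using hl.of_lt_imp_lt ht

end NominationLists

/-! ### The Metropolis–Hastings sampler -/

section Sampler

/-- A finite irreducible Markov chain visits every state of positive stationary mass infinitely
often. -/
lemma IsMarkovChain.frequently_eq {Ω : Type*} [MeasurableSpace Ω] {μ : Measure Ω}
    [IsProbabilityMeasure μ] {E : Type*} [Fintype E] [DecidableEq E] {P : Matrix E E ℝ}
    {ν : E → ℝ} {X : ℕ → Ω → E} (hX : IsMarkovChain μ ν P X)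
    (hP : P ∈ Matrix.rowStochastic ℝ E) (hirr : P.IsIrreducible)
    {p : E → ℝ} (hp : ∑ x, p x = 1) (hstat : Matrix.vecMul p P = p) (hpos : ∀ x, 0 < p x) :
    ∀ᵐ ω ∂μ, ∀ x, ∃ᶠ s in atTop, X s ω = x := by
  refine ae_all_iff.2 fun x => ?_
  filter_upwards [hX.tendsto_average hP hirr hp hstat (Pi.single x 1)] with ω hω hnot
  obtain ⟨N, hN⟩ := eventually_atTop.1 hnot
  -- If `x` were not visited from time `N` on, its visit frequency after `N` would be zero, while
  -- the ergodic theorem gives the limit `p x > 0`.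
  have hzero : Tendsto (fun t : ℕ => (∑ s ∈ Finset.Ioc N (N + t),
      (Pi.single x 1 : E → ℝ) (X s ω)) / (t : ℝ)) atTop (𝓝 0) := by
    refine tendsto_const_nhds.congr fun t => ?_
    rw [Finset.sum_eq_zero, zero_div]
    intro s hs
    exact Pi.single_eq_of_ne (hN s (Finset.mem_Ioc.1 hs).1.le) _
  have h := tendsto_nhds_unique hzero (tendsto_average_shift hω N)
  simp only [Pi.single_apply, mul_ite, mul_one, mul_zero, Finset.sum_ite_eq', Finset.mem_univ,
    if_true] at h
  exact (hpos x).ne h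

variable {V : Type*} [Fintype V] [DecidableEq V] {K : ℕ} [NeZero K] {S : Finset V} {b : V → Fin K}
  {Λ : Matrix (Fin K) (Fin K) ℝ} {G : SimpleGraph V} [DecidableRel G.Adj]
  {Ω : Type*} [MeasurableSpace Ω] {μ : Measure Ω} [IsProbabilityMeasure μ]
  {ν : Labeling S b → ℝ} {X : ℕ → Ω → Labeling S b}

/-- The ergodic theorem for the indicator of `φ.1 v = 0`, valid for any initial distribution `ν`. -/
lemma IsMarkovChain.tendsto_empiricalProb (hΛ : ∀ i j, Λ i j ∈ Set.Ioo (0 : ℝ) 1)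
    (hX : IsMarkovChain μ ν (mhChain S b Λ G) X) (T : ℕ) :
    ∀ᵐ ω ∂μ, ∀ v, Tendsto (fun t => empiricalProb (fun s => X s ω) T t v) atTop
      (𝓝 (posteriorProb S b Λ G v)) := by
  refine ae_all_iff.2 fun v => ?_
  have hP := mhChain_mem_rowStochastic (S := S) (b := b) (G := G) hΛ
  filter_upwards [hX.tendsto_average hP (isIrreducible_mhChain hΛ) (sum_posterior hΛ)
    (vecMul_eq_of_isReversible hP (isReversible_mhChain hΛ))
    (fun φ => if φ.1 v = 0 then 1 else 0)] with ω hω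
  have hlim : ∑ φ : Labeling S b, posterior S b Λ G φ * (if φ.1 v = 0 then 1 else 0) =
      posteriorProb S b Λ G v := by
    simp [posteriorProb, Finset.sum_filter]
  rw [hlim] at hω
  refine (tendsto_average_shift hω T).congr fun t => ?_
  rw [Finset.sum_boole]
  rfl

end Sampler

end VertexNomination

open VertexNomination in
theorem mainTheorem2 {V : Type*} [Fintype V] [DecidableEq V] {K : ℕ} [NeZero K]
    (S : Finset V) (b : V → Fin K) (Λ : Matrix (Fin K) (Fin K) ℝ)
    (hΛ : ∀ i j, Λ i j ∈ Set.Ioo (0 : ℝ) 1) (G : SimpleGraph V) [DecidableRel G.Adj] :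
    -- the base chain is a symmetric Markov chain on `Φ` (as soon as `Φ` has more than one element)
    (1 < Fintype.card (VertexNomination.Labeling S b) →
      VertexNomination.baseChain S b ∈
        Matrix.rowStochastic ℝ (VertexNomination.Labeling S b) ∧
      (VertexNomination.baseChain S b).IsSymm) ∧
    -- the Metropolis–Hastings chain is a Markov chain on the finite set `Φ`
    VertexNomination.mhChain S b Λ G ∈
      Matrix.rowStochastic ℝ (VertexNomination.Labeling S b) ∧
    -- it is reversible with respect to the posterior, which is its stationary distribution
    VertexNomination.IsReversible (VertexNomination.posterior S b Λ G)
      (VertexNomination.mhChain S b Λ G) ∧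
    (∑ φ, VertexNomination.posterior S b Λ G φ = 1 ∧
      Matrix.vecMul (VertexNomination.posterior S b Λ G) (VertexNomination.mhChain S b Λ G) =
        VertexNomination.posterior S b Λ G) ∧
    -- it is irreducible
    (VertexNomination.mhChain S b Λ G).IsIrreducible ∧
    -- it is aperiodic, outside the degenerate case in which no two ambiguous vertices share a block
    -- and the posterior is uniform
    (¬ (2 ≤ Sᶜ.card ∧
        (∀ i, VertexNomination.blockSize b i - VertexNomination.seedSize S b i ≤ 1) ∧
        ∀ φ ψ, VertexNomination.posterior S b Λ G φ = VertexNomination.posterior S b Λ G ψ) →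
      VertexNomination.IsAperiodic (VertexNomination.mhChain S b Λ G)) ∧
    -- the chain started from the uniform distribution
    ∀ {Ω : Type*} [MeasurableSpace Ω] (μ : Measure Ω) [IsProbabilityMeasure μ]
      (X : ℕ → Ω → VertexNomination.Labeling S b),
      VertexNomination.IsMarkovChain μ
        (fun _ => 1 / (Fintype.card (VertexNomination.Labeling S b) : ℝ))
        (VertexNomination.mhChain S b Λ G) X →
      -- recurrence: every state is visited infinitely often
      (∀ᵐ ω ∂μ, ∀ φ, ∃ᶠ s in atTop, X s ω = φ) ∧
      ∀ T : ℕ,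
        -- the empirical frequencies converge to the posterior probabilities
        (∀ᵐ ω ∂μ, ∀ v ∈ Sᶜ,
          Tendsto (fun t => VertexNomination.empiricalProb (fun s => X s ω) T t v) atTop
            (𝓝 (VertexNomination.posteriorProb S b Λ G v))) ∧
        -- eventually every canonical sampling list is a canonical list
        (∀ᵐ ω ∂μ, ∀ᶠ t in atTop, ∀ l : Fin (Sᶜ).card ≃ (Sᶜ : Finset V),
          VertexNomination.IsNominationList Sᶜ
              (VertexNomination.empiricalProb (fun s => X s ω) T t) l →
            VertexNomination.IsNominationList Sᶜ (VertexNomination.posteriorProb S b Λ G) l) ∧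
        -- so it is the canonical list if the posterior probabilities have no ties
        (Set.InjOn (VertexNomination.posteriorProb S b Λ G) (Sᶜ : Finset V) →
          ∀ l₀ : Fin (Sᶜ).card ≃ (Sᶜ : Finset V),
            VertexNomination.IsNominationList Sᶜ (VertexNomination.posteriorProb S b Λ G) l₀ →
            ∀ᵐ ω ∂μ, ∀ᶠ t in atTop, ∀ l : Fin (Sᶜ).card ≃ (Sᶜ : Finset V),
              VertexNomination.IsNominationList Sᶜ
                (VertexNomination.empiricalProb (fun s => X s ω) T t) l → l = l₀) := by
  have hP := mhChain_mem_rowStochastic (S := S) (b := b) (G := G) hΛ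
  have hrev := isReversible_mhChain (S := S) (b := b) (G := G) hΛ
  have hstat := vecMul_eq_of_isReversible hP hrev
  have hirr := isIrreducible_mhChain (S := S) (b := b) (G := G) hΛ
  refine ⟨fun hcard => ?_, hP, hrev, ⟨sum_posterior hΛ, hstat⟩, hirr, isAperiodic_mhChain hΛ, ?_⟩
  · have := Fintype.one_lt_card_iff_nontrivial.1 hcard
    exact ⟨baseChain_mem_rowStochastic, Matrix.IsSymm.ext fun φ ψ => baseChain_symm ψ φ⟩
  intro Ω _ μ _ X hX
  refine ⟨hX.frequently_eq hP hirr (sum_posterior hΛ) hstat (posterior_pos hΛ), fun T => ?_⟩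
  have hconv := hX.tendsto_empiricalProb hΛ T
  have hlist : ∀ᵐ ω ∂μ, ∀ᶠ t in atTop, ∀ l : Fin (Sᶜ).card ≃ (Sᶜ : Finset V),
      IsNominationList Sᶜ (empiricalProb (fun s => X s ω) T t) l →
        IsNominationList Sᶜ (posteriorProb S b Λ G) l := by
    filter_upwards [hconv] with ω hω using eventually_isNominationList fun v _ => hω v
  refine ⟨?_, hlist, fun hinj l₀ hl₀ => ?_⟩
  · filter_upwards [hconv] with ω hω v _ using hω v
  · filter_upwards [hlist] with ω hω
    filter_upwards [hω] with t ht l hl using (ht l hl).unique hinj hl₀
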